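/- **Setting.** Let $S,U^p,U^a$ be finite sets, $p(\cdot\mid\theta,u^p,u^a)$ a transition kernel on $S$, $K\subset\mathbb R^d$ compact, and $\kappa:S\times U^p\times U^a\to K$ a reward function. Let $\Pi^p$ (resp. $\Pi^a$) be the set of maps from $S$ to the probability distributions on $U^p$ (resp. $U^a$). Assume that for every fixed pair $(\pi^p,\pi^a)\in\Pi^p\times\Pi^a$ the resulting Markov chain on $S$ is ergodic (irreducibility is enough), let $\eta^{(\pi^p,\pi^a)}$ be its stationary distribution, and put $$\bar\kappa(\pi^p,\pi^a)=\sum_{\theta,u^p,u^a}\kappa(\theta,u^p,u^a)\,\eta^{(\pi^p,\pi^a)}(\theta)\,\pi^p(u^p|\theta)\,\pi^a(u^a|\theta),\qquad R(\pi^p)=\{\bar\kappa(\pi^p,\pi^a):\pi^a\in\Pi^a\}.$$ Let $\emptyset\ne D\subset K$ with $\bar D$ convex, and let $y_{\bar D}$ denote the point of $\bar D$ closest to $y$. For each $x\in K\setminus\bar D$ let $\pi^p_x\in\Pi^p$ and $\rho(x)>0$ be such that $\inf_{\pi^a}\langle\bar\kappa(\pi^p_x,\pi^a)-x_{\bar D},x_{\bar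 D}-x\rangle>0$ and $\inf_{y\in B(x,\rho(x))}\inf_{\pi^a}\langle\bar\kappa(\pi^p_x,\pi^a)-y_{\bar D},y_{\bar D}-y\rangle>0$. For $n\ge0$ let $K_n=\{y\in K:\operatorname{dist}(y,D)\in[\frac1{n+1},\frac1n]\}$ (with $\frac10=\infty$), let $\mathcal Q_n\subset K_n$ be finite with $K_n\subset\bigcup_{q\in\mathcal Q_n}B(q,\rho(q)/2)$, and let $\mathcal Q=\bigcup_n\mathcal Q_n$. Let $I:\mathcal Q\to\mathbb N$ be injective, and for $x\in K\setminus\bar D$ let $Q(x)$ be the $q\in\mathcal Q$ with $x\in B(q,\rho(q)/2)$ for which $I(q)$ is least. Let $v_{\max}=\sup_{x\in K}\sup_{\theta,u^p,u^a}\|\kappa(\theta,u^p,u^a)-x\|$ and let $T:\mathcal Q\to\mathbb R$ satisfy $\frac{\rho(q)}{4v_{\max}}<T(q)<\frac{\rho(q)}{3v_{\max}}$. Fix any $\pi^p_0\in\Pi^p$ and put $t(n)=\sum_{i=1}^n\frac1i$. **Play.** Let $\theta_n,u^p_n,u^a_n$ be the states and actions at times $n\ge0$, let $\kappa_n=\kappa(\theta_n,u^p_n,u^a_n)$,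 and let $x_{n+1}=x_n+\frac1{n+1}(\kappa_n-x_n)$ be the average reward, started at an arbitrary $x_0\in\mathbb R^d$. The switching times are $s_0=0$ and, if $x_{s_n}\in K\setminus\bar D$, $s_{n+1}=\min\{m:\sum_{i=s_n}^{m-1}\frac1i>T(Q(x_{s_n}))\}$ (the term $i=0$ is omitted if $s_n=0$), while $s_{n+1}=s_n+1$ otherwise. At the times $s_n\le j<s_{n+1}$ the player uses the strategy $\pi^p_{Q(x_{s_n})}$ if $x_{s_n}\in K\setminus\bar D$, and $\pi^p_0$ otherwise. At each time the adversary uses a strategy in $\Pi^a$ chosen in an arbitrary way depending on the past. Given the past (any filtration containing the history), the two actions are drawn independently from the two current strategies evaluated at the current state, and then the next state is drawn from $p$. **Conditions $(\dag)$** on a path, a strictly increasing sequence $m(n)$, integers $s_{m(n)}\le l_{m(n)}<r_{m(n)}\le s_{m(n)+1}$, reals $T_l<T_r$ and $q\in\mathcal Q$: (1) $x_{s_{m(n)}}\to x$ for some $x\in K\setminus\bar D$; (2) $x_{s_{m(n)}}\in K\setminus\bar D$ and $Q(x_{s_{m(n)}})=q$ for all $n$; (3) $[T_l,T_r)\subset[0,T(q))$;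 (4) $t(l_{m(n)})-t(s_{m(n)})\to T_l$ and $t(r_{m(n)})-t(s_{m(n)})\to T_r$. **Statement.** Whatever the adversary's behaviour, almost surely the following holds: for all (possibly path-dependent) choices of $m(n),l_{m(n)},r_{m(n)},T_l,T_r,q$ which satisfy $(\dag)$, $$\lim_{n\to\infty}\ \inf_{\pi^a\in\Pi^a}\left\|\frac{\sum_{j=l_{m(n)}}^{r_{m(n)}-1}\kappa(\theta_j,u^p_j,u^a_j)}{r_{m(n)}-l_{m(n)}}-\bar\kappa(\pi^p_q,\pi^a)\right\|=0,$$ that is, the averages of the rewards over the windows $[l_{m(n)},r_{m(n)})$ converge to the set $R(\pi^p_q)$. Moreover, $\lim_n r_{m(n)}/l_{m(n)}=\exp(T_r-T_l)$, and hence $\lim_n (r_{m(n)}-l_{m(n)})/l_{m(n)}=\exp(T_r-T_l)-1$. -/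

import Mathlib

open MeasureTheory ProbabilityTheory Filter Topology

noncomputable section

namespace Approach

/-- The reward space `ℝ^d` with its Euclidean norm. -/
abbrev Vec (d : ℕ) : Type := EuclideanSpace ℝ (Fin d)

/-- Stationary randomized strategies: maps from states to probability vectors on actions. -/
abbrev Strategy (S U : Type*) [Fintype U] : Type _ := S → stdSimplex ℝ U

/-- A controlled Markov chain with two controllers and a vector reward: `p θ a b` is the law of
the next state and `κ θ a b` the reward, in state `θ` under the player's action `a` and the
adversary's action `b`. -/
structure Game (S Up Ua : Type*) [Fintype S] (d : ℕ) where
  p : S → Up → Ua → stdSimplex ℝ S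
  κ : S → Up → Ua → Vec d

section Stationary

variable {S Up Ua : Type*} [Fintype S] [Fintype Up] [Fintype Ua] {d : ℕ}

/-- Transition matrix of the state process under a fixed pair of strategies. -/
def Game.trans (G : Game S Up Ua d) (πp : Strategy S Up) (πa : Strategy S Ua) : Matrix S S ℝ :=
  fun θ θ' => ∑ a, ∑ b, πp θ a * πa θ b * G.p θ a b θ'

/-- `η` is a stationary probability vector of the transition matrix `P`. -/
def IsStationary (P : Matrix S S ℝ) (η : S → ℝ) : Prop :=
  η ∈ stdSimplex ℝ S ∧ ∀ θ', ∑ θ, η θ * P θ θ' = η θ'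

/-- The chain is ergodic under every fixed pair of strategies. Only irreducibility is demanded,
so aperiodic and periodic irreducible chains are both covered. -/
def Game.Ergodic (G : Game S Up Ua d) : Prop :=
  ∀ (πp : Strategy S Up) (πa : Strategy S Ua), (G.trans πp πa).IsIrreducible

/-- The stationary probability vector of the chain under a fixed pair of strategies
(it exists and is unique when the chain is irreducible). -/
def Game.statDist (G : Game S Up Ua d) (πp : Strategy S Up) (πa : Strategy S Ua) : S → ℝ :=
  Classical.epsilon (IsStationary (G.trans πp πa))

/-- The stationary average reward of a pair of strategies. -/
def Game.meanReward (G : Game S Up Ua d) (πp : Strategy S Up) (πa : Strategy S Ua) : Vec d :=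
  ∑ θ, ∑ a, ∑ b, (G.statDist πp πa θ * πp θ a * πa θ b) • G.κ θ a b

/-- The set of stationary average rewards achievable against the player's strategy `πp`. -/
def Game.rewardSet (G : Game S Up Ua d) (πp : Strategy S Up) : Set (Vec d) :=
  Set.range (G.meanReward πp)

/-- `v_max`, the supremum of `‖κ(θ, u^p, u^a) - x‖` over `x ∈ K` and all `θ, u^p, u^a`. -/
def Game.vmax (G : Game S Up Ua d) (K : Set (Vec d)) : ℝ :=
  sSup {v | ∃ x ∈ K, ∃ θ a b, v = ‖G.κ θ a b - x‖}

end Stationary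

/-- The point of the closure of `D` closest to `y`. -/
def proj {d : ℕ} (D : Set (Vec d)) (y : Vec d) : Vec d :=
  Classical.epsilon fun z => z ∈ closure D ∧ dist y z = Metric.infDist y (closure D)

/-- The layer `K_n` of points of `K` whose distance to `D` lies in `[1/(n+1), 1/n]`; for `n = 0`
the upper end is infinite, so that the layers exhaust `K \ closure D`. -/
def layer {d : ℕ} (K D : Set (Vec d)) (n : ℕ) : Set (Vec d) :=
  {y | y ∈ K ∧ 1 / ((n : ℝ) + 1) ≤ Metric.infDist y D ∧ (n : ℝ) * Metric.infDist y D ≤ 1}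

/-- Rescaled time `t(n) = 1 + 1/2 + ... + 1/n`. -/
def clock (n : ℕ) : ℝ := ∑ i ∈ Finset.Icc 1 n, (1 : ℝ) / i

/-- Average reward: `x_{n+1} = x_n + (g_n - x_n)/(n+1)`, started at `x₀`. -/
def average {d : ℕ} (x₀ : Vec d) (g : ℕ → Vec d) : ℕ → Vec d
  | 0 => x₀
  | n + 1 => average x₀ g n + (1 / ((n : ℝ) + 1)) • (g n - average x₀ g n)

section Scheme

variable {S Up Ua : Type*} [Fintype S] [Fintype Up] [Fintype Ua] {d : ℕ}

/-- The choices which determine the player's scheme: strategies `π^p_x` and radii `ρ(x)` for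
`x ∈ K \ closure D`, a fallback strategy `π^p_0`, finite nets `𝒬_n` of the layers `K_n`, an
injective numbering `I` of the union `𝒬` of the nets, and durations `T(q)` for `q ∈ 𝒬`.
The values of `strat`, `ρ`, `I`, `T` outside these domains play no role. -/
structure Scheme (G : Game S Up Ua d) (K D : Set (Vec d)) where
  strat : Vec d → Strategy S Up
  strat₀ : Strategy S Up
  ρ : Vec d → ℝ
  net : ℕ → Finset (Vec d)
  I : Vec d → ℕ
  T : Vec d → ℝ
  /-- Blackwell's condition:
  `inf_{π^a} ⟨κ̄(π^p_x, π^a) - x_{D̄}, x_{D̄} - x⟩ > 0`. -/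
  blackwell : ∀ x ∈ K \ closure D, ∃ ε > 0, ∀ πa : Strategy S Ua,
    ε ≤ inner ℝ (G.meanReward (strat x) πa - proj D x) (proj D x - x)
  ρ_pos : ∀ x ∈ K \ closure D, 0 < ρ x
  /-- The same strategy works on the whole ball:
  `inf_{y ∈ B(x, ρ(x))} inf_{π^a} ⟨κ̄(π^p_x, π^a) - y_{D̄}, y_{D̄} - y⟩ > 0`. -/
  ρ_spec : ∀ x ∈ K \ closure D, ∃ ε > 0, ∀ y ∈ Metric.ball x (ρ x), ∀ πa : Strategy S Ua,
    ε ≤ inner ℝ (G.meanReward (strat x) πa - proj D y) (proj D y - y)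
  net_subset : ∀ n, (net n : Set (Vec d)) ⊆ layer K D n
  net_cover : ∀ n, layer K D n ⊆ ⋃ q ∈ net n, Metric.ball q (ρ q / 2)
  I_injOn : Set.InjOn I (⋃ n, (net n : Set (Vec d)))
  T_spec : ∀ q ∈ (⋃ n, (net n : Set (Vec d))),
    ρ q / (4 * G.vmax K) < T q ∧ T q < ρ q / (3 * G.vmax K)

variable {G : Game S Up Ua d} {K D : Set (Vec d)}

/-- The countable set `𝒬`, the union of the nets. -/
def Scheme.centers (C : Scheme G K D) : Set (Vec d) := ⋃ n, (C.net n : Set (Vec d))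

/-- `q` has the least number among the points of `𝒬` with `x ∈ B(q, ρ(q)/2)`. -/
def Scheme.IsLeastCenter (C : Scheme G K D) (x q : Vec d) : Prop :=
  (q ∈ C.centers ∧ x ∈ Metric.ball q (C.ρ q / 2)) ∧
    ∀ q' ∈ C.centers, x ∈ Metric.ball q' (C.ρ q' / 2) → C.I q ≤ C.I q'

/-- The map `Q : K \ closure D → 𝒬`. -/
def Scheme.center (C : Scheme G K D) (x : Vec d) : Vec d :=
  Classical.epsilon (C.IsLeastCenter x)

open Classical in
/-- The strategy adopted at a switching time at which the average reward is `x`: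
`π^p_{Q(x)}` if `x ∈ K \ closure D`, and `π^p_0` otherwise. -/
def Scheme.adopt (C : Scheme G K D) (x : Vec d) : Strategy S Up :=
  if x ∈ K \ closure D then C.strat (C.center x) else C.strat₀

open Classical in
/-- The switching times `s_n` along a sequence `x` of average rewards: `s_0 = 0`; if
`x_{s_n} ∈ K \ closure D`, then `s_{n+1}` is the least `m` with
`∑_{i = s_n}^{m-1} 1/i > T(Q(x_{s_n}))`, and otherwise `s_{n+1} = s_n + 1`.
When `s_n = 0` the undefined term `i = 0` is left out of the sum. -/
def Scheme.switch (C : Scheme G K D) (x : ℕ → Vec d) : ℕ → ℕ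
  | 0 => 0
  | n + 1 =>
    if x (C.switch x n) ∈ K \ closure D then
      sInf {m : ℕ | C.T (C.center (x (C.switch x n))) <
        ∑ i ∈ Finset.Ico (max 1 (C.switch x n)) m, (1 : ℝ) / i}
    else C.switch x n + 1

open Classical in
/-- The last switching time `s_k ≤ j` (note that `k ≤ s_k`). -/
def Scheme.lastSwitch (C : Scheme G K D) (x : ℕ → Vec d) (j : ℕ) : ℕ :=
  C.switch x (Nat.findGreatest (fun k => C.switch x k ≤ j) j)

/-- The player's strategy at time `j`: the one adopted at the last switching time. -/
def Scheme.current (C : Scheme G K D) (x : ℕ → Vec d) (j : ℕ) : Strategy S Up :=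
  C.adopt (x (C.lastSwitch x j))

/-- The sequence of rewards along given states and actions. -/
def Game.reward (G : Game S Up Ua d) {Ω : Type*} (θ : ℕ → Ω → S) (up : ℕ → Ω → Up)
    (ua : ℕ → Ω → Ua) (ω : Ω) (n : ℕ) : Vec d :=
  G.κ (θ n ω) (up n ω) (ua n ω)

/-- States `θ`, player's actions `up` and adversary's actions `ua` form a play in which the player
follows the scheme and the adversary uses the strategies `α n`, chosen at time `n` in an arbitrary
way from the past `ℱ n` (any filtration that contains the history). Given the past, the two
actions at time `n` are drawn independently from the current strategies and then the next state
from the transition kernel. -/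
structure IsPlay (C : Scheme G K D) (x₀ : Vec d) {Ω : Type*} [mΩ : MeasurableSpace Ω]
    (μ : Measure Ω) (ℱ : Filtration ℕ mΩ) (θ : ℕ → Ω → S) (up : ℕ → Ω → Up) (ua : ℕ → Ω → Ua)
    (α : ℕ → Ω → Strategy S Ua) : Prop where
  meas_state : ∀ n i, MeasurableSet[ℱ n] {ω | θ n ω = i}
  meas_player : ∀ n a, MeasurableSet[ℱ (n + 1)] {ω | up n ω = a}
  meas_adversary : ∀ n b, MeasurableSet[ℱ (n + 1)] {ω | ua n ω = b}
  meas_strategy : ∀ n i b, Measurable[ℱ n] fun ω => α n ω i b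
  step : ∀ n a b i,
    μ⟦{ω | up n ω = a ∧ ua n ω = b ∧ θ (n + 1) ω = i} | ℱ n⟧ =ᵐ[μ] fun ω =>
      C.current (average x₀ (G.reward θ up ua ω)) n (θ n ω) a * α n ω (θ n ω) b *
        G.p (θ n ω) a b i

/-- The conditions `(†)` along one path `x` of average rewards: `s_{m(n)}` is a subsequence of the
switching times, the windows `[l n, r n)` satisfy `s_{m(n)} ≤ l n < r n ≤ s_{m(n)+1}`, and

1. `x_{s_{m(n)}}` converges to a point of `K \ closure D`;
2. `Q(x_{s_{m(n)}}) = q ∈ 𝒬` for all `n` (in particular `x_{s_{m(n)}}` is in the domain of `Q`);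
3. `[T_l, T_r) ⊆ [0, T(q))`;
4. `t(l n) - t(s_{m(n)}) → T_l` and `t(r n) - t(s_{m(n)}) → T_r`. -/
structure Dagger (C : Scheme G K D) (x : ℕ → Vec d) (m l r : ℕ → ℕ) (Tl Tr : ℝ)
    (q : Vec d) : Prop where
  strictMono : StrictMono m
  lt : Tl < Tr
  window : ∀ n, C.switch x (m n) ≤ l n ∧ l n < r n ∧ r n ≤ C.switch x (m n + 1)
  tendsto : ∃ z ∈ K \ closure D, Tendsto (fun n => x (C.switch x (m n))) atTop (𝓝 z)
  mem_centers : q ∈ C.centers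
  center_eq : ∀ n, x (C.switch x (m n)) ∈ K \ closure D ∧ C.center (x (C.switch x (m n))) = q
  subset : Set.Ico Tl Tr ⊆ Set.Ico 0 (C.T q)
  tendsto_left : Tendsto (fun n => clock (l n) - clock (C.switch x (m n))) atTop (𝓝 Tl)
  tendsto_right : Tendsto (fun n => clock (r n) - clock (C.switch x (m n))) atTop (𝓝 Tr)

end Scheme

end Approach

end

/-! On a window the player uses the single strategy `C.strat q`. Replace each observed transition
(θ_j, u^p_j, u^a_j, θ_{j+1}) by its conditional law. The averaged law is then exactly `Game.flow` of
w, the window average of the law of state and adversary's action given the past. Observed inflow and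
outflow of a state differ by a telescoping boundary term, so every limit point of w is balanced.
Disintegrating such a limit over the state gives a stationary adversary strategy whose stationary
vector, unique by irreducibility, is the state marginal (`Game.sum_flow_smul_mem_rewardSet`).
Compactness of the simplex turns this into convergence to the reward set
(`Game.tendsto_infDist_rewardSet`).

The replacement is a martingale strong law (`ae_tendsto_average_indicator_sub_condExp`), used only
for prefixes [0, n) and finitely many transitions, so one null set serves all path-dependent
windows. As t(n) - log n converges, r/l tends to exp(T_r - T_l) > 1. A window thus fills a positive
fraction of [0, r), and an o(n) error on prefixes stays negligible on it
(`tendsto_window_average_zero`). -/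

namespace Approach

/-! ### Strong law for bounded martingale differences. -/

section StrongLaw

/-- Kronecker's lemma for the weights `n + 1`. -/
theorem tendsto_average_zero_of_tendsto_sum_div {e : ℕ → ℝ} {c : ℝ}
    (h : Tendsto (fun n => ∑ j ∈ Finset.range n, e j / ((j : ℝ) + 1)) atTop (𝓝 c)) :
    Tendsto (fun n : ℕ => (n : ℝ)⁻¹ * ∑ j ∈ Finset.range n, e j) atTop (𝓝 0) := by
  set M : ℕ → ℝ := fun n => ∑ j ∈ Finset.range n, e j / ((j : ℝ) + 1) with hM
  -- Abel summation: the average of e is M minus its Cesàro mean, and both have limit c.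
  have key : ∀ n : ℕ, ∑ j ∈ Finset.range n, e j = n * M n - ∑ j ∈ Finset.range n, M j := by
    intro n
    induction n with
    | zero => simp
    | succ n ih =>
      have h1 : M (n + 1) = M n + e n / ((n : ℝ) + 1) := Finset.sum_range_succ _ _
      have h2 : ((n : ℝ) + 1) ≠ 0 := by positivity
      rw [Finset.sum_range_succ, Finset.sum_range_succ, ih, h1]
      push_cast
      field_simp
      ring
  have h1 := h.sub h.cesaro
  rw [sub_self] at h1
  refine h1.congr' ?_
  filter_upwards [eventually_ne_atTop 0] with n hn
  have h2 : (n : ℝ) ≠ 0 := by exact_mod_cast hn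
  rw [key n]
  field_simp

variable {Ω : Type*} [mΩ : MeasurableSpace Ω] {μ : Measure Ω} [IsProbabilityMeasure μ]
  {ℱ : Filtration ℕ mΩ}

/-- Strong law of large numbers for bounded martingale differences. -/
theorem ae_tendsto_average_martingaleDiff {e : ℕ → Ω → ℝ} {c : ℝ}
    (hmeas : ∀ n, StronglyMeasurable[ℱ (n + 1)] (e n))
    (hbdd : ∀ n, ∀ᵐ ω ∂μ, |e n ω| ≤ c) (hcond : ∀ n, μ[e n | ℱ n] =ᵐ[μ] 0) :
    ∀ᵐ ω ∂μ, Tendsto (fun n : ℕ => (n : ℝ)⁻¹ * ∑ j ∈ Finset.range n, e j ω) atTop (𝓝 0) := by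
  have hmeas' : ∀ n, StronglyMeasurable (e n) := fun n => (hmeas n).mono (ℱ.le _)
  have hint : ∀ n, Integrable (e n) μ := fun n =>
    Integrable.of_bound (hmeas' n).aestronglyMeasurable c (hbdd n)
  set M : ℕ → Ω → ℝ := fun n ω => ∑ j ∈ Finset.range n, e j ω / ((j : ℝ) + 1) with hM
  have hsucc : ∀ n, M (n + 1) = fun ω => M n ω + e n ω / ((n : ℝ) + 1) := fun n => by
    funext ω
    exact Finset.sum_range_succ _ _
  have hMmeas : ∀ n, StronglyMeasurable[ℱ n] (M n) := by
    intro n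
    refine Finset.stronglyMeasurable_fun_sum _ fun j hj => ?_
    simp only [div_eq_mul_inv]
    exact StronglyMeasurable.mul_const ((hmeas j).mono (ℱ.mono (Finset.mem_range.1 hj))) _
  have hMbdd : ∀ n, ∃ C, ∀ᵐ ω ∂μ, ‖M n ω‖ ≤ C := by
    intro n
    induction n with
    | zero => exact ⟨0, by simp [hM]⟩
    | succ n ih =>
      obtain ⟨C, hC⟩ := ih
      refine ⟨C + c / ((n : ℝ) + 1), ?_⟩
      filter_upwards [hC, hbdd n] with ω h1 h2
      rw [hsucc]
      refine (norm_add_le _ _).trans (add_le_add h1 ?_)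
      rw [norm_div, Real.norm_eq_abs, Real.norm_of_nonneg (by positivity : (0 : ℝ) ≤ (n : ℝ) + 1)]
      gcongr
  have hMint : ∀ n, Integrable (M n) μ := fun n => by
    obtain ⟨C, hC⟩ := hMbdd n
    exact Integrable.of_bound ((hMmeas n).mono (ℱ.le n)).aestronglyMeasurable C hC
  have hmart : Martingale M ℱ μ := by
    refine martingale_of_condExp_sub_eq_zero_nat hMmeas hMint fun n => ?_
    have h1 : M (n + 1) - M n = (((n : ℝ) + 1)⁻¹) • e n := by
      funext ω
      simp only [hsucc, Pi.sub_apply, Pi.smul_apply, smul_eq_mul]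
      ring
    rw [h1]
    refine (condExp_smul _ _ _).trans ?_
    filter_upwards [hcond n] with ω h
    simp [h]
  have hsqint : ∀ n, Integrable (fun ω => M n ω ^ 2) μ := fun n => by
    obtain ⟨C, hC⟩ := hMbdd n
    refine Integrable.of_bound (((hMmeas n).mono (ℱ.le n)).pow 2).aestronglyMeasurable (C ^ 2) ?_
    filter_upwards [hC] with ω h
    rw [norm_pow]
    gcongr
  have hcross : ∀ n, Integrable (fun ω => M n ω * e n ω) μ ∧ ∫ ω, M n ω * e n ω ∂μ = 0 := by
    intro n
    obtain ⟨C, hC⟩ := hMbdd n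
    refine ⟨(hint n).bdd_mul ((hMmeas n).mono (ℱ.le n)).aestronglyMeasurable hC, ?_⟩
    have h1 := condExp_stronglyMeasurable_mul_of_bound (ℱ.le n) (hMmeas n) (hint n) C hC
    have h2 := integral_condExp (μ := μ) (f := M n * e n) (ℱ.le n)
    change ∫ ω, (M n * e n) ω ∂μ = 0
    rw [← h2, integral_congr_ae h1]
    refine integral_eq_zero_of_ae ?_
    filter_upwards [hcond n] with ω h
    simp [h]
  have hsqe : ∀ n, Integrable (fun ω => e n ω ^ 2) μ ∧ ∫ ω, e n ω ^ 2 ∂μ ≤ c ^ 2 := by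
    intro n
    have h1 : ∀ᵐ ω ∂μ, e n ω ^ 2 ≤ c ^ 2 := by
      filter_upwards [hbdd n] with ω h
      rw [← sq_abs]
      gcongr
    have h2 : Integrable (fun ω => e n ω ^ 2) μ := by
      refine Integrable.of_bound ((hmeas' n).pow 2).aestronglyMeasurable (c ^ 2) ?_
      filter_upwards [h1] with ω h
      rwa [Real.norm_of_nonneg (sq_nonneg _)]
    refine ⟨h2, (integral_mono_ae h2 (integrable_const _) h1).trans ?_⟩
    simp
  -- Increments are orthogonal to the past, so second moments add up; the weights 1/(j+1) make the
  -- total finite.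
  have hsq : ∀ n, ∫ ω, M n ω ^ 2 ∂μ ≤
      ∑ j ∈ Finset.range n, c ^ 2 * (1 / ((j + 1 : ℕ) : ℝ) ^ 2) := by
    intro n
    induction n with
    | zero => simp [hM]
    | succ n ih =>
      have h1 : (fun ω => M (n + 1) ω ^ 2) = fun ω => (M n ω ^ 2 +
          (2 / ((n : ℝ) + 1)) * (M n ω * e n ω)) + (1 / ((n : ℝ) + 1) ^ 2) * e n ω ^ 2 := by
        funext ω
        simp only [hsucc]
        field_simp
        ring
      have h2 : Integrable (fun ω => M n ω ^ 2 + (2 / ((n : ℝ) + 1)) * (M n ω * e n ω)) μ :=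
        (hsqint n).add ((hcross n).1.const_mul _)
      rw [h1, integral_add h2 ((hsqe n).1.const_mul _),
        integral_add (hsqint n) ((hcross n).1.const_mul _), integral_const_mul,
        integral_const_mul, (hcross n).2, Finset.sum_range_succ, mul_zero, add_zero]
      refine add_le_add ih ?_
      rw [mul_comm]
      push_cast
      gcongr
      exact (hsqe n).2
  have hsum : Summable fun j : ℕ => c ^ 2 * (1 / ((j + 1 : ℕ) : ℝ) ^ 2) :=
    ((summable_nat_add_iff 1).2 (Real.summable_one_div_nat_pow.2 one_lt_two)).mul_left _
  set B : ℝ := ∑' j : ℕ, c ^ 2 * (1 / ((j + 1 : ℕ) : ℝ) ^ 2)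
  have hB : ∀ n, ∫ ω, M n ω ^ 2 ∂μ ≤ B := fun n =>
    (hsq n).trans (hsum.sum_le_tsum _ fun j _ => by positivity)
  -- The L² bound gives the L¹ bound of Doob's convergence theorem through |x| ≤ 1 + x².
  have hL1 : ∀ n, eLpNorm (M n) 1 μ ≤ ((1 + B).toNNReal : NNReal) := by
    intro n
    rw [eLpNorm_one_eq_lintegral_enorm, ← ofReal_integral_norm_eq_lintegral_enorm (hMint n)]
    refine ENNReal.ofReal_le_ofReal ?_
    calc ∫ ω, ‖M n ω‖ ∂μ ≤ ∫ ω, (1 + M n ω ^ 2) ∂μ := by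
          refine integral_mono (hMint n).norm ((integrable_const _).add (hsqint n)) fun ω => ?_
          simp only [Real.norm_eq_abs]
          nlinarith [sq_abs (M n ω), sq_nonneg (|M n ω| - 1), abs_nonneg (M n ω)]
      _ = 1 + ∫ ω, M n ω ^ 2 ∂μ := by
          rw [integral_add (integrable_const _) (hsqint n)]
          simp
      _ ≤ 1 + B := by linarith [hB n]
  filter_upwards [hmart.submartingale.exists_ae_tendsto_of_bdd hL1] with ω hω
  obtain ⟨l, hl⟩ := hω
  exact tendsto_average_zero_of_tendsto_sum_div hl

/-- Conditional strong law of large numbers: the frequency of adapted events is asymptotically the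
average of their conditional probabilities. -/
theorem ae_tendsto_average_indicator_sub_condExp {A : ℕ → Set Ω}
    (hA : ∀ n, MeasurableSet[ℱ (n + 1)] (A n)) :
    ∀ᵐ ω ∂μ, Tendsto (fun n : ℕ => (n : ℝ)⁻¹ * ∑ j ∈ Finset.range n,
      ((A j).indicator (fun _ => (1 : ℝ)) ω - (μ⟦A j | ℱ j⟧) ω)) atTop (𝓝 0) := by
  have hind : ∀ n, Integrable ((A n).indicator fun _ => (1 : ℝ)) μ := fun n =>
    (integrable_const _).indicator (ℱ.le _ _ (hA n))
  have hle : ∀ n ω, |(A n).indicator (fun _ => (1 : ℝ)) ω| ≤ 1 := fun n ω => by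
    by_cases h : ω ∈ A n <;> simp [h]
  refine ae_tendsto_average_martingaleDiff (ℱ := ℱ) (c := 2) (fun n => ?_) (fun n => ?_)
    (fun n => ?_)
  · exact (stronglyMeasurable_const.indicator (hA n)).sub
      (stronglyMeasurable_condExp.mono (ℱ.mono n.le_succ))
  · filter_upwards [ae_bdd_abs_condExp_of_ae_bdd_abs (m := ℱ n) (Eventually.of_forall (hle n))] with ω h
    refine (abs_sub _ _).trans ?_
    have h1 := hle n ω
    linarith
  · refine (condExp_sub (hind n) integrable_condExp _).trans ?_
    rw [condExp_of_stronglyMeasurable (ℱ.le n) stronglyMeasurable_condExp integrable_condExp,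
      sub_self]

end StrongLaw

/-! ### Uniqueness of the stationary vector. -/

section Uniqueness

variable {S : Type*} [Fintype S]

/-- A nonnegative invariant vector of an irreducible matrix with a zero entry vanishes. -/
theorem eq_zero_of_invariant_of_apply_eq_zero {P : Matrix S S ℝ} (hP : P.IsIrreducible)
    {w : S → ℝ} (hw : ∀ i, 0 ≤ w i) (hinv : ∀ j, ∑ i, w i * P i j = w j) {k : S}
    (hk : w k = 0) : w = 0 := by
  classical
  have hpow : ∀ n : ℕ, Matrix.vecMul w (P ^ n) = w := by
    intro n
    induction n with
    | zero => simp
    | succ n ih =>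
      rw [pow_succ, ← Matrix.vecMul_vecMul, ih]
      exact funext hinv
  have hpos := (Matrix.isIrreducible_iff_exists_pow_pos hP.nonneg).1 hP
  funext i
  -- Some power has a positive entry from i to k, so mass at i would reach k.
  obtain ⟨n, -, hn⟩ := hpos i k
  have h1 : ∑ i, w i * (P ^ n) i k = 0 := (congrFun (hpow n) k).trans hk
  have h2 : ∀ i ∈ Finset.univ, 0 ≤ w i * (P ^ n) i k := fun i _ =>
    mul_nonneg (hw i) (Matrix.pow_apply_nonneg hP.nonneg n i k)
  have h3 := (Finset.sum_eq_zero_iff_of_nonneg h2).1 h1 i (Finset.mem_univ _)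
  exact (mul_eq_zero.1 h3).resolve_right hn.ne'

/-- An irreducible matrix has at most one stationary probability vector. -/
theorem IsStationary.eq {P : Matrix S S ℝ} (hP : P.IsIrreducible) {η ν : S → ℝ}
    (hη : IsStationary P η) (hν : IsStationary P ν) : η = ν := by
  have hne : Nonempty S := by
    by_contra h
    rw [not_nonempty_iff] at h
    simpa using hη.1.2
  have hpos : ∀ i, 0 < η i := fun i => by
    refine lt_of_le_of_ne (hη.1.1 i) fun h => ?_
    have h0 := eq_zero_of_invariant_of_apply_eq_zero hP hη.1.1 hη.2 h.symm
    simpa [h0] using hη.1.2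
  -- With c the least ratio, ν - cη is nonnegative, invariant and zero at k, hence zero.
  obtain ⟨k, hk⟩ := Finite.exists_min fun i => ν i / η i
  set c := ν k / η k
  have h0 := eq_zero_of_invariant_of_apply_eq_zero hP (w := fun i => ν i - c * η i) (k := k)
    (fun i => sub_nonneg.2 ((le_div_iff₀ (hpos i)).1 (hk i)))
    (fun j => by
      simp only [sub_mul, Finset.sum_sub_distrib, mul_assoc, ← Finset.mul_sum]
      rw [hν.2, hη.2])
    (by simp [c, div_mul_cancel₀ _ (hpos k).ne'])
  have h1 : ∀ i, ν i = c * η i := fun i => sub_eq_zero.1 (congrFun h0 i)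
  have h2 : c = 1 := by
    have h3 := hν.1.2
    simp only [h1, ← Finset.mul_sum] at h3
    rwa [hη.1.2, mul_one] at h3
  funext i
  rw [h1, h2, one_mul]

/-- Under ergodicity, any stationary vector is the chosen one. -/
theorem Game.statDist_eq {Up Ua : Type*} [Fintype Up] [Fintype Ua] {d : ℕ}
    {G : Game S Up Ua d} (hG : G.Ergodic) {πp : Strategy S Up} {πa : Strategy S Ua} {ν : S → ℝ}
    (hν : IsStationary (G.trans πp πa) ν) : G.statDist πp πa = ν :=
  IsStationary.eq (hG πp πa) (Classical.epsilon_spec ⟨ν, hν⟩) hν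

end Uniqueness

/-! ### Harmonic time and ratios of times. -/

section Clock

theorem clock_eq_harmonic (n : ℕ) : clock n = (harmonic n : ℝ) := by
  rw [harmonic_eq_sum_Icc, clock]
  simp

/-- The two index sets overlap on purpose: this costs nothing and spares the cases k = 0 and k > m.
-/
theorem clock_le_add_sum_Ico {k m : ℕ} : clock m ≤ clock (k + 1) +
    ∑ i ∈ Finset.Ico (max 1 k) (m + 1), (1 : ℝ) / i := by
  have h : Finset.Icc 1 m ⊆ Finset.Icc 1 (k + 1) ∪ Finset.Ico (max 1 k) (m + 1) := by
    intro i
    simp only [Finset.mem_Icc, Finset.mem_union, Finset.mem_Ico]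
    omega
  refine (Finset.sum_le_sum_of_subset_of_nonneg h fun i _ _ => by positivity).trans ?_
  rw [clock, ← Finset.sum_union_inter]
  exact le_add_of_nonneg_right (Finset.sum_nonneg fun i _ => by positivity)

theorem tendsto_clock_atTop : Tendsto clock atTop atTop := by
  refine tendsto_atTop_mono (f := fun n : ℕ => Real.log ((n + 1 : ℕ) : ℝ)) (fun n => ?_) ?_
  · rw [clock_eq_harmonic]
    exact log_add_one_le_harmonic n
  · exact Real.tendsto_log_atTop.comp
      (tendsto_natCast_atTop_atTop.comp (tendsto_add_atTop_nat 1))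

/-- Partial harmonic sums from any starting index exceed any bound. -/
theorem exists_lt_sum_Ico_one_div (k : ℕ) (c : ℝ) :
    ∃ m : ℕ, c < ∑ i ∈ Finset.Ico (max 1 k) m, (1 : ℝ) / i := by
  obtain ⟨m, hm⟩ := (tendsto_clock_atTop.eventually_gt_atTop (clock (k + 1) + c)).exists
  refine ⟨m + 1, ?_⟩
  have := clock_le_add_sum_Ico (k := k) (m := m)
  linarith

/-- A limiting increment of the rescaled time determines the limiting ratio of the times. -/
theorem tendsto_div_of_tendsto_clock_sub {l r : ℕ → ℕ} {T : ℝ} (hl : Tendsto l atTop atTop)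
    (hr : Tendsto r atTop atTop)
    (h : Tendsto (fun n => clock (r n) - clock (l n)) atTop (𝓝 T)) :
    Tendsto (fun n => (r n : ℝ) / (l n : ℝ)) atTop (𝓝 (Real.exp T)) := by
  have hγ : Tendsto (fun n : ℕ => clock n - Real.log n) atTop
      (𝓝 Real.eulerMascheroniConstant) := by
    simpa only [clock_eq_harmonic] using Real.tendsto_harmonic_sub_log
  -- The Euler–Mascheroni constants cancel, leaving log r - log l → T.
  have h1 := h.sub ((hγ.comp hr).sub (hγ.comp hl))
  rw [sub_self, sub_zero] at h1
  refine (Real.continuous_exp.continuousAt.tendsto.comp h1).congr' ?_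
  filter_upwards [hl.eventually_gt_atTop 0, hr.eventually_gt_atTop 0] with n h2 h3
  have h4 : (0 : ℝ) < l n := by exact_mod_cast h2
  have h5 : (0 : ℝ) < r n := by exact_mod_cast h3
  rw [← Real.exp_log (div_pos h5 h4), Real.log_div h5.ne' h4.ne']
  simp only [Function.comp_apply]
  congr 1
  ring

end Clock

/-! ### From prefix averages to window averages. -/

section Windows

/-- If the averages over `[0, n)` vanish in the limit, so do those over windows whose length is
asymptotically proportional to their left end. -/
theorem tendsto_window_average_zero {e : ℕ → ℝ}
    (he : Tendsto (fun n : ℕ => (n : ℝ)⁻¹ * ∑ j ∈ Finset.range n, e j) atTop (𝓝 0))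
    {l r : ℕ → ℕ} {c : ℝ} (hc : 1 < c) (hl : Tendsto l atTop atTop) (hlr : ∀ n, l n < r n)
    (h : Tendsto (fun n => (r n : ℝ) / (l n : ℝ)) atTop (𝓝 c)) :
    Tendsto (fun n => ((r n : ℝ) - (l n : ℝ))⁻¹ * ∑ j ∈ Finset.Ico (l n) (r n), e j)
      atTop (𝓝 0) := by
  have hr : Tendsto r atTop atTop := tendsto_atTop_mono (fun n => (hlr n).le) hl
  have h1 : Tendsto (fun n => ((r n : ℝ) / (l n : ℝ) - 1)⁻¹) atTop (𝓝 (c - 1)⁻¹) :=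
    (h.sub_const 1).inv₀ (by linarith)
  -- A window average is the prefix average at r with weight r/(r - l) minus the one at l with
  -- weight l/(r - l); both weights converge because c > 1.
  have h2 := (h1.mul h).mul (he.comp hr) |>.sub (h1.mul (he.comp hl))
  simp only [mul_zero, sub_zero] at h2
  refine h2.congr' ?_
  filter_upwards [hl.eventually_gt_atTop 0] with n h3
  have h4 : (0 : ℝ) < l n := by exact_mod_cast h3
  have h5 : (l n : ℝ) < r n := by exact_mod_cast hlr n
  have h6 : (r n : ℝ) - l n ≠ 0 := by linarith
  have h7 : (r n : ℝ) ≠ 0 := by linarith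
  rw [Finset.sum_Ico_eq_sub _ (hlr n).le]
  have h8 : ((r n : ℝ) / (l n : ℝ) - 1)⁻¹ = l n * ((r n : ℝ) - l n)⁻¹ := by
    field_simp
  simp only [Function.comp_apply, h8]
  field_simp

end Windows

/-! ### Switching times and the strategy in force. -/

section Switching

variable {S Up Ua : Type*} [Fintype S] [Fintype Up] [Fintype Ua] {d : ℕ}
  {G : Game S Up Ua d} {K D : Set (Vec d)}

theorem exists_mem_layer (hD : D.Nonempty) {x : Vec d} (hx : x ∈ K \ closure D) :
    ∃ n, x ∈ layer K D n := by
  have hpos : 0 < Metric.infDist x D :=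
    lt_of_le_of_ne Metric.infDist_nonneg fun h =>
      hx.2 ((Metric.mem_closure_iff_infDist_zero hD).2 h.symm)
  refine ⟨⌊1 / Metric.infDist x D⌋₊, hx.1, ?_, ?_⟩
  · rw [div_le_comm₀ (by positivity) hpos]
    exact (Nat.lt_floor_add_one _).le
  · rw [← le_div_iff₀ hpos]
    exact Nat.floor_le (by positivity)

theorem layer_subset (hD : D.Nonempty) (n : ℕ) : layer K D n ⊆ K \ closure D := by
  rintro x ⟨h1, h2, -⟩
  refine ⟨h1, fun h => ?_⟩
  rw [(Metric.mem_closure_iff_infDist_zero hD).1 h] at h2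
  have : (0 : ℝ) < 1 / ((n : ℝ) + 1) := by positivity
  linarith

theorem Scheme.isLeastCenter_center (C : Scheme G K D) (hD : D.Nonempty) {x : Vec d}
    (hx : x ∈ K \ closure D) : C.IsLeastCenter x (C.center x) := by
  refine Classical.epsilon_spec (p := C.IsLeastCenter x) ?_
  obtain ⟨n, hn⟩ := exists_mem_layer hD hx
  have h1 := C.net_cover n hn
  simp only [Set.mem_iUnion] at h1
  obtain ⟨q, hq, hxq⟩ := h1
  obtain ⟨q', h2, h3⟩ := exists_minimalFor_of_wellFoundedLT
    (fun q => q ∈ C.centers ∧ x ∈ Metric.ball q (C.ρ q / 2)) C.I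
    ⟨q, Set.mem_iUnion.2 ⟨n, hq⟩, hxq⟩
  refine ⟨q', h2, fun y hy hxy => ?_⟩
  rcases le_total (C.I q') (C.I y) with h | h
  · exact h
  · exact h3 ⟨hy, hxy⟩ h

theorem Scheme.T_pos (C : Scheme G K D) (hD : D.Nonempty) {q : Vec d} (hq : q ∈ C.centers) :
    0 < C.T q := by
  refine lt_of_le_of_lt ?_ (C.T_spec q hq).1
  obtain ⟨n, hn⟩ := Set.mem_iUnion.1 hq
  have h1 := C.ρ_pos q (layer_subset hD n (C.net_subset n hn))
  have h2 : 0 ≤ G.vmax K := Real.sSup_nonneg fun v hv => by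
    obtain ⟨x, -, θ, a, b, rfl⟩ := hv
    exact norm_nonneg _
  -- If `G.vmax K` is 0, division by zero gives the bound 0, which is still enough.
  positivity

/-- A sum exceeding T > 0 cannot be empty, so the next time is later. Divergence of the harmonic
series makes the infimum attained, not the default value 0. -/
theorem Scheme.switch_strictMono (C : Scheme G K D) (hD : D.Nonempty) (x : ℕ → Vec d) :
    StrictMono (C.switch x) := by
  refine strictMono_nat_of_lt_succ fun n => ?_
  rw [Scheme.switch]
  split_ifs with h
  · have h1 := C.T_pos hD (C.isLeastCenter_center hD h).1.1
    set c := C.T (C.center (x (C.switch x n)))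
    set m := sInf {m : ℕ | c < ∑ i ∈ Finset.Ico (max 1 (C.switch x n)) m, (1 : ℝ) / i}
    have h2 : c < ∑ i ∈ Finset.Ico (max 1 (C.switch x n)) m, (1 : ℝ) / i :=
      Nat.sInf_mem (exists_lt_sum_Ico_one_div (C.switch x n) c)
    by_contra h3
    have h4 : Finset.Ico (max 1 (C.switch x n)) m = ∅ := Finset.Ico_eq_empty (by omega)
    rw [h4, Finset.sum_empty] at h2
    linarith
  · exact Nat.lt_succ_self _

theorem Scheme.lastSwitch_eq (C : Scheme G K D) (hD : D.Nonempty) (x : ℕ → Vec d) {k j : ℕ}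
    (h1 : C.switch x k ≤ j) (h2 : j < C.switch x (k + 1)) :
    C.lastSwitch x j = C.switch x k := by
  classical
  have hm := C.switch_strictMono hD x
  unfold Scheme.lastSwitch
  congr 1
  rw [Nat.findGreatest_eq_iff]
  -- The bound k ≤ s_k ≤ j puts k within the search range.
  refine ⟨(hm.id_le k).trans h1, fun _ => h1, fun n hn _ h => ?_⟩
  have := hm.monotone (Nat.succ_le_of_lt hn)
  simp only [Nat.succ_eq_add_one] at this
  omega

theorem Dagger.current_eq {C : Scheme G K D} (hD : D.Nonempty) {x : ℕ → Vec d} {m l r : ℕ → ℕ}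
    {Tl Tr : ℝ} {q : Vec d} (h : Dagger C x m l r Tl Tr q) {n j : ℕ}
    (hj : j ∈ Finset.Ico (l n) (r n)) : C.current x j = C.strat q := by
  obtain ⟨h1, -, h2⟩ := h.window n
  rw [Finset.mem_Ico] at hj
  rw [Scheme.current, C.lastSwitch_eq hD x (h1.trans hj.1) (hj.2.trans_le h2), Scheme.adopt,
    if_pos (h.center_eq n).1, (h.center_eq n).2]

theorem Dagger.tendsto_left_atTop {C : Scheme G K D} (hD : D.Nonempty) {x : ℕ → Vec d}
    {m l r : ℕ → ℕ} {Tl Tr : ℝ} {q : Vec d} (h : Dagger C x m l r Tl Tr q) :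
    Tendsto l atTop atTop :=
  tendsto_atTop_mono (fun n => (h.strictMono.id_le n).trans
    (((C.switch_strictMono hD x).id_le (m n)).trans (h.window n).1)) tendsto_id

theorem Dagger.tendsto_ratio {C : Scheme G K D} (hD : D.Nonempty) {x : ℕ → Vec d}
    {m l r : ℕ → ℕ} {Tl Tr : ℝ} {q : Vec d} (h : Dagger C x m l r Tl Tr q) :
    Tendsto (fun n => (r n : ℝ) / (l n : ℝ)) atTop (𝓝 (Real.exp (Tr - Tl))) := by
  have hl := h.tendsto_left_atTop hD
  refine tendsto_div_of_tendsto_clock_sub hl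
    (tendsto_atTop_mono (fun n => (h.window n).2.1.le) hl) ?_
  simpa using h.tendsto_right.sub h.tendsto_left

end Switching

/-! ### Occupation measures and their stationary limits. -/

section OccupationMeasures

variable {S Up Ua : Type*} [Fintype S] [Fintype Up] [Fintype Ua] {d : ℕ}

/-- The law of a transition `(θ, u^p, u^a, θ')` when `(θ, u^a)` has law `w` and the player uses the
strategy `πp`. -/
def Game.flow (G : Game S Up Ua d) (πp : Strategy S Up) (w : S × Ua → ℝ)
    (t : S × Up × Ua × S) : ℝ :=
  w (t.1, t.2.2.1) * πp t.1 t.2.1 * G.p t.1 t.2.1 t.2.2.1 t.2.2.2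

/-- The average reward of a stationary law of state and adversary's action belongs to the set of
stationary average rewards. -/
theorem Game.sum_flow_smul_mem_rewardSet {G : Game S Up Ua d} (hG : G.Ergodic)
    (πp : Strategy S Up) [Nonempty (Strategy S Ua)] {w : S × Ua → ℝ}
    (hw : w ∈ stdSimplex ℝ (S × Ua)) [DecidableEq S]
    (hflow : ∀ k, ∑ t, G.flow πp w t * (if t.1 = k then 1 else 0) =
      ∑ t, G.flow πp w t * (if t.2.2.2 = k then 1 else 0)) :
    ∑ t, G.flow πp w t • G.κ t.1 t.2.1 t.2.2.1 ∈ G.rewardSet πp := by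
  obtain ⟨πa₀⟩ := ‹Nonempty (Strategy S Ua)›
  set ν : S → ℝ := fun s => ∑ b, w (s, b) with hν
  have hνnn : ∀ s, 0 ≤ ν s := fun s => Finset.sum_nonneg fun b _ => hw.1 _
  have hex : ∀ s, ∃ β : stdSimplex ℝ Ua, ∀ b, w (s, b) = ν s * β b := by
    intro s
    -- At a state without mass the conditional law is arbitrary, and `πa₀` supplies one.
    by_cases h : ν s = 0
    · refine ⟨πa₀ s, fun b => ?_⟩
      rw [h, zero_mul]
      exact (Finset.sum_eq_zero_iff_of_nonneg fun b _ => hw.1 (s, b)).1 h b (Finset.mem_univ _)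
    · refine ⟨⟨fun b => w (s, b) / ν s, fun b => div_nonneg (hw.1 _) (hνnn s), ?_⟩, fun b => ?_⟩
      · rw [← Finset.sum_div]
        exact div_self h
      · exact (mul_div_cancel₀ _ h).symm
  choose β hβ using hex
  have hstat : IsStationary (G.trans πp β) ν := by
    refine ⟨⟨hνnn, ?_⟩, fun k => ?_⟩
    · rw [← hw.2, Fintype.sum_prod_type]
    · have h := hflow k
      simp only [Fintype.sum_prod_type, Game.flow, mul_ite, mul_one, mul_zero,
        Finset.sum_ite_eq', Finset.mem_univ, if_true] at h
      have h1 : ∑ s, ∑ a, ∑ b, ∑ k', (if s = k then w (s, b) * πp s a * G.p s a b k' else 0) =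
          ν k := by
        rw [Finset.sum_eq_single k (fun s _ hs => by simp [hs]) (by simp)]
        simp only [if_true, ← Finset.mul_sum, stdSimplex.sum_eq_one, mul_one]
        rw [Finset.sum_comm]
        simp only [← Finset.mul_sum, stdSimplex.sum_eq_one, mul_one, hν]
      rw [← h1, h]
      refine Finset.sum_congr rfl fun s _ => ?_
      simp only [Game.trans, Finset.mul_sum, hβ]
      refine Finset.sum_congr rfl fun a _ => Finset.sum_congr rfl fun b _ => ?_
      ring
  refine ⟨β, ?_⟩
  rw [Game.meanReward, Game.statDist_eq hG hstat]
  simp only [Fintype.sum_prod_type, Game.flow, hβ]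
  refine Finset.sum_congr rfl fun s _ => Finset.sum_congr rfl fun a _ =>
    Finset.sum_congr rfl fun b _ => ?_
  rw [← Finset.sum_smul, ← Finset.mul_sum, stdSimplex.sum_eq_one, mul_one]
  congr 1
  ring

/-- Averages along a sequence in a finite type are integrals against its occupation measure. -/
theorem sum_occupation_smul {X E : Type*} [Fintype X] [DecidableEq X] [AddCommGroup E]
    [Module ℝ E] (τ : ℕ → X) (f : X → E) (c : ℝ) (s : Finset ℕ) :
    ∑ t, (c * ∑ j ∈ s, if τ j = t then (1 : ℝ) else 0) • f t = c • ∑ j ∈ s, f (τ j) := by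
  simp only [mul_smul, ← Finset.smul_sum, Finset.sum_smul, ite_smul, one_smul, zero_smul]
  rw [Finset.sum_comm]
  simp

open Classical in
/-- If along windows of growing length the transitions occur as often as their conditional
probabilities under the strategy `πp` of the player, then the average rewards over the windows
approach the set of stationary average rewards against `πp`. -/
theorem Game.tendsto_infDist_rewardSet {G : Game S Up Ua d} (hG : G.Ergodic)
    (πp : Strategy S Up) (θ : ℕ → S) (up : ℕ → Up) (ua : ℕ → Ua) (α : ℕ → Strategy S Ua)
    {l r : ℕ → ℕ} (hlr : ∀ n, l n < r n)
    (hlen : Tendsto (fun n => (r n : ℝ) - (l n : ℝ)) atTop atTop)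
    (h : ∀ t : S × Up × Ua × S, Tendsto (fun n => ((r n : ℝ) - (l n : ℝ))⁻¹ *
      ∑ j ∈ Finset.Ico (l n) (r n), ((if (θ j, up j, ua j, θ (j + 1)) = t then (1 : ℝ) else 0) -
        if θ j = t.1 then πp t.1 t.2.1 * α j t.1 t.2.2.1 * G.p t.1 t.2.1 t.2.2.1 t.2.2.2 else 0))
      atTop (𝓝 0)) :
    Tendsto (fun n => Metric.infDist (((r n : ℝ) - (l n : ℝ))⁻¹ •
      ∑ j ∈ Finset.Ico (l n) (r n), G.κ (θ j) (up j) (ua j)) (G.rewardSet πp)) atTop (𝓝 0) := by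
  have : Nonempty (Strategy S Ua) := ⟨α 0⟩
  have hpos : ∀ n, (0 : ℝ) < (r n : ℝ) - (l n : ℝ) := fun n =>
    sub_pos.2 (by exact_mod_cast hlr n)
  set τ : ℕ → S × Up × Ua × S := fun j => (θ j, up j, ua j, θ (j + 1)) with hτ
  set z : ℕ → S × Up × Ua × S → ℝ := fun n t => ((r n : ℝ) - (l n : ℝ))⁻¹ *
    ∑ j ∈ Finset.Ico (l n) (r n), if τ j = t then (1 : ℝ) else 0 with hz
  -- The weights are the conditional probabilities `α j`, not the observed adversary actions; this
  -- makes the averaged conditional law equal to `G.flow πp (w n)`.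
  set w : ℕ → S × Ua → ℝ := fun n y => ((r n : ℝ) - (l n : ℝ))⁻¹ *
    ∑ j ∈ Finset.Ico (l n) (r n), if θ j = y.1 then α j y.1 y.2 else 0 with hw
  have hws : ∀ n, w n ∈ stdSimplex ℝ (S × Ua) := by
    refine fun n => ⟨fun y => mul_nonneg (inv_nonneg.2 (hpos n).le)
      (Finset.sum_nonneg fun j _ => ?_), ?_⟩
    · split_ifs
      · exact stdSimplex.zero_le _ _
      · exact le_rfl
    · rw [← Finset.mul_sum, Finset.sum_comm]
      have h1 : ∀ j, ∑ y : S × Ua, (if θ j = y.1 then α j y.1 y.2 else 0) = 1 := fun j => by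
        rw [Fintype.sum_prod_type]
        simp_rw [Finset.sum_ite_irrel, stdSimplex.sum_eq_one]
        simp
      simp only [h1, Finset.sum_const, Nat.card_Ico, nsmul_eq_mul, mul_one,
        Nat.cast_sub (hlr n).le]
      exact inv_mul_cancel₀ (hpos n).ne'
  have hzw : ∀ t, Tendsto (fun n => z n t - G.flow πp (w n) t) atTop (𝓝 0) := by
    refine fun t => (h t).congr fun n => ?_
    simp only [hz, hw, Game.flow, Finset.sum_sub_distrib, mul_sub, mul_assoc, Finset.sum_mul,
      ite_mul, zero_mul]
    congr 2
    refine Finset.sum_congr rfl fun j _ => ?_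
    split_ifs
    · ring
    · rfl
  have hflux : ∀ k, Tendsto (fun n => ∑ t, z n t * (if t.1 = k then (1 : ℝ) else 0) -
      ∑ t, z n t * (if t.2.2.2 = k then (1 : ℝ) else 0)) atTop (𝓝 0) := by
    intro k
    refine squeeze_zero_norm (a := fun n => ((r n : ℝ) - (l n : ℝ))⁻¹) (fun n => ?_)
      (tendsto_inv_atTop_zero.comp hlen)
    have h1 := sum_occupation_smul τ (fun t => if t.1 = k then (1 : ℝ) else 0)
      ((r n : ℝ) - (l n : ℝ))⁻¹ (Finset.Ico (l n) (r n))
    have h2 := sum_occupation_smul τ (fun t => if t.2.2.2 = k then (1 : ℝ) else 0)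
      ((r n : ℝ) - (l n : ℝ))⁻¹ (Finset.Ico (l n) (r n))
    simp only [smul_eq_mul] at h1 h2
    simp only [hz]
    rw [h1, h2, ← mul_sub, norm_mul, norm_sub_rev, ← Finset.sum_sub_distrib]
    simp only [hτ]
    -- Exits from k and entries into k telescope to a difference of two indicators.
    rw [Finset.sum_Ico_sub (fun j => if θ j = k then (1 : ℝ) else 0) (hlr n).le, Real.norm_of_nonneg (inv_nonneg.2 (hpos n).le)]
    refine mul_le_of_le_one_right (inv_nonneg.2 (hpos n).le) ?_
    split_ifs <;> simp
  have hrew : ∀ n, ((r n : ℝ) - (l n : ℝ))⁻¹ • ∑ j ∈ Finset.Ico (l n) (r n),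
      G.κ (θ j) (up j) (ua j) = ∑ t, z n t • G.κ t.1 t.2.1 t.2.2.1 := fun n =>
    (sum_occupation_smul τ (fun t => G.κ t.1 t.2.1 t.2.2.1) _ _).symm
  simp only [hrew]
  -- The target may vary with the subsequence: it suffices that each limit lies in the reward set.
  refine tendsto_of_subseq_tendsto fun ns hns => ?_
  obtain ⟨w', hw', φ, hφm, hφ⟩ :=
    (isCompact_stdSimplex ℝ (S × Ua)).tendsto_subseq fun n => hws (ns n)
  refine ⟨φ, ?_⟩
  have hφns : Tendsto (fun n => ns (φ n)) atTop atTop := hns.comp hφm.tendsto_atTop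
  have hlimz : ∀ t, Tendsto (fun n => z (ns (φ n)) t) atTop (𝓝 (G.flow πp w' t)) := by
    intro t
    have h1 : Tendsto (fun n => G.flow πp (w (ns (φ n))) t) atTop (𝓝 (G.flow πp w' t)) :=
      ((tendsto_pi_nhds.1 hφ _).mul_const _).mul_const _
    simpa using ((hzw t).comp hφns).add h1
  have hmem := G.sum_flow_smul_mem_rewardSet hG πp hw' fun k => by
    refine sub_eq_zero.1 (tendsto_nhds_unique ?_ ((hflux k).comp hφns))
    exact (tendsto_finsetSum _ fun t _ => (hlimz t).mul_const _).sub
      (tendsto_finsetSum _ fun t _ => (hlimz t).mul_const _)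
  have hlim : Tendsto (fun n => ∑ t, z (ns (φ n)) t • G.κ t.1 t.2.1 t.2.2.1) atTop
      (𝓝 (∑ t, G.flow πp w' t • G.κ t.1 t.2.1 t.2.2.1)) :=
    tendsto_finsetSum _ fun t _ => (hlimz t).smul_const _
  exact squeeze_zero (fun n => Metric.infDist_nonneg) (fun n => Metric.infDist_le_dist_of_mem hmem)
    (tendsto_iff_dist_tendsto_zero.1 hlim)

end OccupationMeasures

/-! ### The strong law along a play. -/

section Play

variable {S Up Ua : Type*} [Fintype S] [Fintype Up] [Fintype Ua] {d : ℕ}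
  {G : Game S Up Ua d} {K D : Set (Vec d)}

open Classical in
/-- Almost surely, along a play transitions occur as often as predicted by their conditional
probabilities. -/
theorem IsPlay.ae_tendsto_average {C : Scheme G K D} {x₀ : Vec d} {Ω : Type*}
    [mΩ : MeasurableSpace Ω] {μ : Measure Ω} [IsProbabilityMeasure μ] {ℱ : Filtration ℕ mΩ}
    {θ : ℕ → Ω → S} {up : ℕ → Ω → Up} {ua : ℕ → Ω → Ua} {α : ℕ → Ω → Strategy S Ua}
    (h : IsPlay C x₀ μ ℱ θ up ua α) :
    ∀ᵐ ω ∂μ, ∀ t : S × Up × Ua × S, Tendsto (fun n : ℕ => (n : ℝ)⁻¹ * ∑ j ∈ Finset.range n,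
      ((if (θ j ω, up j ω, ua j ω, θ (j + 1) ω) = t then (1 : ℝ) else 0) -
        if θ j ω = t.1 then C.current (average x₀ (G.reward θ up ua ω)) j t.1 t.2.1 *
          α j ω t.1 t.2.2.1 * G.p t.1 t.2.1 t.2.2.1 t.2.2.2 else 0)) atTop (𝓝 0) := by
  rw [ae_all_iff]
  rintro ⟨s, a, b, k⟩
  set A : ℕ → Set Ω := fun n => {ω | up n ω = a ∧ ua n ω = b ∧ θ (n + 1) ω = k} with hA
  have hAmeas : ∀ n, MeasurableSet[ℱ (n + 1)] (A n) := fun n =>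
    (h.meas_player n a).inter ((h.meas_adversary n b).inter (h.meas_state (n + 1) k))
  have hB : ∀ n, MeasurableSet[ℱ (n + 1)] ({ω | θ n ω = s} ∩ A n) := fun n =>
    (ℱ.mono n.le_succ _ (h.meas_state n s)).inter (hAmeas n)
  -- The state at time n is known at time n, so its indicator leaves the conditional expectation.
  have hcond : ∀ n, μ⟦{ω | θ n ω = s} ∩ A n | ℱ n⟧ =ᵐ[μ]
      {ω | θ n ω = s}.indicator (μ⟦A n | ℱ n⟧) := fun n => by
    rw [← Set.indicator_indicator]
    exact condExp_indicator ((integrable_const _).indicator (ℱ.le _ _ (hAmeas n)))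
      (h.meas_state n s)
  filter_upwards [ae_tendsto_average_indicator_sub_condExp (μ := μ) hB, ae_all_iff.2 hcond,
    ae_all_iff.2 fun n => h.step n a b k] with ω h1 h2 h3
  refine h1.congr fun n => ?_
  congr 1
  refine Finset.sum_congr rfl fun j _ => ?_
  congr 1
  · simp only [Set.indicator_apply, hA, Set.mem_inter_iff, Set.mem_ofPred_eq, Prod.mk.injEq]
  · rw [h2, Set.indicator_apply]
    simp only [Set.mem_ofPred_eq]
    split_ifs with hs
    · rw [h3, hs]
    · rfl

end Play

end Approach

theorem mainTheorem2 {S Up Ua : Type*} [Fintype S] [Fintype Up] [Fintype Ua] {d : ℕ}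
    (G : Approach.Game S Up Ua d) (hG : G.Ergodic)
    (K : Set (Approach.Vec d)) (hK : IsCompact K) (hκ : ∀ θ a b, G.κ θ a b ∈ K)
    (D : Set (Approach.Vec d)) (hDK : D ⊆ K) (hD : D.Nonempty) (hconv : Convex ℝ (closure D))
    (C : Approach.Scheme G K D) (x₀ : Approach.Vec d)
    {Ω : Type*} [mΩ : MeasurableSpace Ω] (μ : Measure Ω) [IsProbabilityMeasure μ]
    (ℱ : Filtration ℕ mΩ) (θ : ℕ → Ω → S) (up : ℕ → Ω → Up) (ua : ℕ → Ω → Ua)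
    (α : ℕ → Ω → Approach.Strategy S Ua) (hplay : Approach.IsPlay C x₀ μ ℱ θ up ua α) :
    ∀ᵐ ω ∂μ, ∀ (m l r : ℕ → ℕ) (Tl Tr : ℝ) (q : Approach.Vec d),
      Approach.Dagger C (Approach.average x₀ (G.reward θ up ua ω)) m l r Tl Tr q →
        Tendsto (fun n => Metric.infDist
            (((r n : ℝ) - (l n : ℝ))⁻¹ • ∑ j ∈ Finset.Ico (l n) (r n), G.reward θ up ua ω j)
            (G.rewardSet (C.strat q))) atTop (𝓝 0) ∧
          Tendsto (fun n => (r n : ℝ) / (l n : ℝ)) atTop (𝓝 (Real.exp (Tr - Tl))) ∧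
          Tendsto (fun n => ((r n : ℝ) - (l n : ℝ)) / (l n : ℝ)) atTop
            (𝓝 (Real.exp (Tr - Tl) - 1)) := by
  classical
  filter_upwards [hplay.ae_tendsto_average] with ω hω m l r Tl Tr q hdag
  have hl := hdag.tendsto_left_atTop hD
  have hratio := hdag.tendsto_ratio hD
  have hc : 1 < Real.exp (Tr - Tl) := Real.one_lt_exp_iff.2 (sub_pos.2 hdag.lt)
  have hlr : ∀ n, l n < r n := fun n => (hdag.window n).2.1
  have hdiff : Tendsto (fun n => ((r n : ℝ) - (l n : ℝ)) / (l n : ℝ)) atTop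
      (𝓝 (Real.exp (Tr - Tl) - 1)) := by
    refine (hratio.sub_const 1).congr' ?_
    filter_upwards [hl.eventually_gt_atTop 0] with n hn
    rw [sub_div, div_self (by exact_mod_cast hn.ne')]
  have hlen : Tendsto (fun n => (r n : ℝ) - (l n : ℝ)) atTop atTop := by
    refine (hdiff.pos_mul_atTop (sub_pos.2 hc) (tendsto_natCast_atTop_atTop.comp hl)).congr' ?_
    filter_upwards [hl.eventually_gt_atTop 0] with n hn
    exact div_mul_cancel₀ _ (by exact_mod_cast hn.ne')
  refine ⟨?_, hratio, hdiff⟩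
  refine Approach.Game.tendsto_infDist_rewardSet hG (C.strat q) (fun j => θ j ω)
    (fun j => up j ω) (fun j => ua j ω) (fun j => α j ω) hlr hlen fun t => ?_
  refine (Approach.tendsto_window_average_zero (hω t) hc hl hlr hratio).congr fun n => ?_
  congr 1
  refine Finset.sum_congr rfl fun j hj => ?_
  -- Prefixes mix many strategies; only inside the window is the current one `C.strat q`.
  rw [hdag.current_eq hD hj]
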